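/- All graphs are finite and simple, and a family of graphs is understood up to isomorphism. Call a family $\mathcal F$ of graphs hereditary if it is closed under taking subgraphs, where it suffices that for every $H\in\mathcal F$ all subgraphs of $H$ that have at least one edge and no isolated vertices belong to $\mathcal F$. For a graph $G$, let $D(G|\mathcal F)$ be the set of all graphs $G-E(D)$, where $D$ is a subgraph of $G$ with $D\in\mathcal F$ (only the edges of $D$ are deleted), and let $\chi_{\mathcal F}(G)=\min\{\chi(H): H\in D(G|\mathcal F)\}$. The graph $G$ is stable with respect to $\mathcal F$ if $\chi_{\mathcal F}(G)=\chi(G)$. Let $f(n,G|\mathcal F)$ be the smallest positive integer $k$ such that in every coloring of the edges of $K_n$ that uses at least $k$ colors there is a copy of $G$ in which, for every color that occurs, the edges of that color (together with their end vertices) form a member of $\mathcal F$. Let $\mathrm{ex}(n,H)$ be the maximum number of edges of a graph on $n$ vertices that does not contain $H$ as a subgraph. Theorem. Let $\mathcal F$ be a hereditary family of graphs that contains at least one graph with an edge (equivalently, $K_2\in\mathcal F$), and let $G$ be a graph that is stable with respect to $\mathcal F$. If $\chi_{\mathcal F}(G)\ge 3$, then, as $n\to\infty$, $$f(n,G|\mathcal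 F)=(1+o(1))\,\mathrm{ex}(n,K_{\chi(G)}).$$ -/

import Mathlib

open Filter Asymptotics
open scoped SimpleGraph

/-- A family of finite graphs, given by representatives on the vertex sets `Fin n`.
Membership is always taken up to isomorphism, see `GraphFamily.Mem`. -/
abbrev GraphFamily : Type := Set (Σ n : ℕ, SimpleGraph (Fin n))

namespace GraphFamily

/-- The graph `H` belongs to the family `F`, up to isomorphism. -/
def Mem (F : GraphFamily) {V : Type*} (H : SimpleGraph V) : Prop :=
  ∃ K ∈ F, Nonempty (H ≃g K.2)

/-- `F` is hereditary: closed under taking subgraphs (`H' ⊑ H` says that `H'` is isomorphic to a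
subgraph of `H`). Only subgraphs with at least one edge and without isolated vertices are required
to be in `F`. So every family closed under all subgraphs is hereditary, and so are families such
as the one of all matchings `t K₂`, `t ≥ 1`. -/
def IsHereditary (F : GraphFamily) : Prop :=
  ∀ (n m : ℕ) (H : SimpleGraph (Fin n)) (H' : SimpleGraph (Fin m)),
    F.Mem H → H' ⊑ H → H' ≠ ⊥ → H'.support = Set.univ → F.Mem H'

/-- The `F`-deck of `G`: all graphs obtained from `G` by deleting the edges of a
subgraph `D` of `G` that belongs to `F`. -/
def deck (F : GraphFamily) {V : Type*} (G : SimpleGraph V) : Set (SimpleGraph V) :=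
  {H | ∃ D : G.Subgraph, F.Mem D.coe ∧ H = G.deleteEdges D.edgeSet}

/-- The reduced chromatic number of `G` with respect to `F`: the minimum of the chromatic numbers
of the members of the `F`-deck of `G` (it is `⊤` if the deck is empty). -/
noncomputable def reducedChromaticNumber (F : GraphFamily) {V : Type*} (G : SimpleGraph V) : ℕ∞ :=
  ⨅ H ∈ F.deck G, H.chromaticNumber

/-- `G` is stable with respect to `F`. -/
def IsStable (F : GraphFamily) {V : Type*} (G : SimpleGraph V) : Prop :=
  F.reducedChromaticNumber G = G.chromaticNumber

/-- The set of colors that occur on at least one edge in the edge coloring `c`. -/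
def usedColors {V : Type*} {G : SimpleGraph V} (c : G.EdgeLabeling ℕ) : Set ℕ :=
  {k | c.labelGraph k ≠ ⊥}

/-- An edge coloring `c` of `G` is an `F`-coloring if each color class of `c` induces a member of
`F`. The graph induced by a set of edges consists of these edges and their end vertices. -/
def IsFColoring (F : GraphFamily) {V : Type*} {G : SimpleGraph V}
    (c : G.EdgeLabeling ℕ) : Prop :=
  ∀ k ∈ usedColors c, F.Mem ((c.labelGraph k).induce (c.labelGraph k).support)

/-- `f(n, G | F)`: the smallest positive integer `k` such that every edge coloring of the complete
graph on `n` vertices that uses at least `k` colors has a copy of `G` in which every color class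
induces a member of `F`. -/
noncomputable def antiRamsey (F : GraphFamily) {V : Type*} (G : SimpleGraph V) (n : ℕ) : ℕ :=
  sInf {k : ℕ | 1 ≤ k ∧ ∀ c : SimpleGraph.TopEdgeLabeling (Fin n) ℕ,
    k ≤ (usedColors c).ncard → ∃ φ : G.Copy (⊤ : SimpleGraph (Fin n)),
      F.IsFColoring (SimpleGraph.EdgeLabeling.pullback c φ.toHom)}

end GraphFamily

open SimpleGraph

/-! Let χ(G) = r + 1, so r ≥ 2. The claim follows from ex(n, K_{r+1}) < f(n, G | F) ≤ ex(n, G) + 1.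
Upper bound: pick one edge of each color; with more than ex(n, G) colors these edges contain G, and
this rainbow copy is an F-copy because K₂ ∈ F. Lower bound: give the edges of the r-partite Turán
graph distinct colors and all other edges one extra color 0. Deleting color 0 from an F-copy of G
leaves an r-colorable graph, which is G itself or a member of its deck; stability excludes both. By
Erdős–Stone–Simonovits (`exists_extremalNumber_le`) and the Turán count, both ends are (1 - 1/r)
n²/2 + o(n²), and r ≥ 2 makes the main term quadratic. -/

/-! ### Extremal numbers: Erdős–Stone–Simonovits asymptotics -/

/-- A finite `k`-colorable graph is contained in a complete equipartite graph with `k` parts. -/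
theorem SimpleGraph.Colorable.isContained_completeEquipartiteGraph {V : Type*} [Fintype V]
    {G : SimpleGraph V} {k : ℕ} (hG : G.Colorable k) : G ⊑ completeEquipartiteGraph k (Fintype.card V) := by
  classical
  obtain ⟨C⟩ := hG
  exact isContained_completeEquipartiteGraph_of_colorable C _ fun c => Fintype.card_subtype_le _

/-- The extremal number grows by at most the minimum degree of an extremal graph. -/
theorem SimpleGraph.extremalNumber_succ_le {V : Type*} {G : SimpleGraph V} {n : ℕ}
    {H : SimpleGraph (Fin (n + 1))} [DecidableRel H.Adj] (hH : H.IsExtremal G.Free) :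
    extremalNumber (n + 1) G ≤ extremalNumber n G + H.minDegree := by
  obtain ⟨v, hv⟩ := H.exists_minimal_degree_vertex
  have h1 := card_edgeFinset_of_isExtremal_free hH
  have h2 := card_edgeFinset_deleteIncidenceSet_le_extremalNumber hH.1 v
  have h3 := H.card_edgeFinset_deleteIncidenceSet v
  simp only [Fintype.card_fin, Nat.add_sub_cancel] at h1 h2
  omega

/-- The upper bound of the Erdős–Stone–Simonovits theorem. -/
theorem SimpleGraph.exists_extremalNumber_le {V : Type*} [Fintype V] {G : SimpleGraph V} {r : ℕ}
    (hbot : G ≠ ⊥) (hG : G.Colorable (r + 1)) (hr : 1 ≤ r) {ε : ℝ} (hε : 0 < ε) :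
    ∃ K : ℝ, ∀ᶠ n : ℕ in atTop,
      (extremalNumber n G : ℝ) ≤ K + (1 - 1 / r + ε) * (n * (n + 1) / 2) := by
  classical
  obtain ⟨N, hN⟩ := eventually_atTop.1
    (eventually_completeEquipartiteGraph_isContained_of_minDegree hε r (Fintype.card V))
  have hc : 0 ≤ 1 - 1 / (r : ℝ) + ε := by
    have : 1 / (r : ℝ) ≤ 1 := by
      rw [div_le_one (by positivity)]
      exact_mod_cast hr
    linarith
  -- Induction from N: each new vertex adds less than (1 - 1/r + ε)(n + 1) edges, the increment of
  -- the bound; the value at N is absorbed in K.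
  refine ⟨extremalNumber N G, eventually_atTop.2 ⟨N, fun n hn => ?_⟩⟩
  induction n, hn using Nat.le_induction with
  | base => exact le_add_of_nonneg_right (by positivity)
  | succ n hn ih =>
    obtain ⟨H, _, hH⟩ := exists_isExtremal_free (V := Fin (n + 1)) hbot
    have h1 : (extremalNumber (n + 1) G : ℝ) ≤ extremalNumber n G + H.minDegree := by
      exact_mod_cast extremalNumber_succ_le hH
    have h2 : (H.minDegree : ℝ) < (1 - 1 / r + ε) * ((n + 1 : ℕ) : ℝ) := by
      by_contra! h
      exact hH.1 (hG.isContained_completeEquipartiteGraph.trans (hN (n + 1) (by omega) h))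
    push_cast at h2 ⊢
    nlinarith

/-- The number of edges of the Turán graph is at least `(1 - 1 / r) n² / 2 - O(1)`. -/
theorem SimpleGraph.le_card_edgeFinset_turanGraph {r : ℕ} (hr : 1 ≤ r) (n : ℕ) :
    (1 - 1 / (r : ℝ)) * n ^ 2 / 2 - (1 + r ^ 2) ≤ (turanGraph n r).edgeFinset.card := by
  have hr' : (1 : ℝ) ≤ r := by exact_mod_cast hr
  have hmr : n % r < r := Nat.mod_lt _ hr
  have hmr' : ((n % r : ℕ) : ℝ) ≤ r := by exact_mod_cast hmr.le
  -- In the final error, 1 pays for the rounded division and r² for the term with n % r; the edges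
  -- counted by the binomial coefficient are dropped.
  have h1 : (n ^ 2 - (n % r) ^ 2) * (r - 1) <
      (turanGraph n r).edgeFinset.card * (2 * r) + 2 * r := by
    rw [card_edgeFinset_turanGraph]
    have := Nat.lt_div_mul_add (a := (n ^ 2 - (n % r) ^ 2) * (r - 1)) (b := 2 * r) (by omega)
    refine this.trans_le ?_
    gcongr
    exact Nat.le_add_right _ _
  have h2 : ((n : ℝ) ^ 2 - ((n % r : ℕ) : ℝ) ^ 2) * (r - 1) <
      (turanGraph n r).edgeFinset.card * (2 * r) + 2 * r := by
    have h := (Nat.cast_lt (α := ℝ)).2 h1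
    rw [Nat.cast_mul, Nat.cast_sub (Nat.pow_le_pow_left (Nat.mod_le _ _) 2), Nat.cast_sub hr] at h
    exact_mod_cast h
  have h3 : ((n % r : ℕ) : ℝ) ^ 2 * (r - 1) ≤ r ^ 2 * (r * 2) := by
    gcongr
    linarith
  have h4 : (1 - 1 / (r : ℝ)) * n ^ 2 / 2 - (1 + r ^ 2) =
      (n ^ 2 * (r - 1) - 2 * r - r ^ 2 * (r * 2)) / (2 * r) := by
    field_simp
    ring
  rw [h4, div_le_iff₀ (by positivity)]
  linarith

/-- A sequence squeezed between `ex(n, K_{r+1})` and `ex(n, G) + 1`, where `G` is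
`(r + 1)`-colorable, is asymptotic to `ex(n, K_{r+1})`. -/
theorem SimpleGraph.isEquivalent_extremalNumber_completeGraph {V : Type*} [Fintype V]
    {G : SimpleGraph V} {r : ℕ} (hbot : G ≠ ⊥) (hG : G.Colorable (r + 1)) (hr : 2 ≤ r) {f : ℕ → ℕ}
    (hlow : ∀ n, extremalNumber n (completeGraph (Fin (r + 1))) ≤ f n)
    (hup : ∀ n, f n ≤ extremalNumber n G + 1) :
    (fun n : ℕ => (f n : ℝ)) ~[atTop]
      (fun n : ℕ => (extremalNumber n (completeGraph (Fin (r + 1))) : ℝ)) := by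
  have hr2 : (2 : ℝ) ≤ r := by exact_mod_cast hr
  have hrinv : 1 / (r : ℝ) ≤ 1 / 2 := by gcongr
  have hrinv' : 0 < 1 / (r : ℝ) := by positivity
  have hlarge : ∀ K δ : ℝ, 0 ≤ K → 0 < δ → ∀ᶠ n : ℕ in atTop, K + n ≤ δ * (n : ℝ) ^ 2 := by
    intro K δ hK hδ
    filter_upwards [tendsto_natCast_atTop_atTop.eventually_ge_atTop ((K + 1) / δ),
      tendsto_natCast_atTop_atTop.eventually_ge_atTop (1 : ℝ)] with n h1 h2
    rw [div_le_iff₀ hδ] at h1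
    nlinarith
  have hturan : ∀ n : ℕ, (1 - 1 / (r : ℝ)) * n ^ 2 / 2 - (1 + r ^ 2) ≤
      extremalNumber n (completeGraph (Fin (r + 1))) := by
    intro n
    have : Nontrivial (Fin (r + 1)) := Fin.nontrivial_iff_two_le.2 (by omega)
    have h := le_card_edgeFinset_turanGraph (r := r) (by omega) n
    rwa [completeGraph, extremalNumber_top, Fintype.card_fin, Nat.add_sub_cancel]
  refine IsLittleO.of_bound fun c hc => ?_
  -- The choice c / 16 turns the ε-part into at most c n²/32 plus a linear term, and the cap 1/2
  -- keeps the whole linear term below n. The total error is then at most c n²/16, while ex(n,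
  -- K_{r+1}) ≥ n²/8.
  obtain ⟨K, hK⟩ := exists_extremalNumber_le hbot hG (by omega) (ε := min (c / 16) (1 / 2))
    (by positivity)
  filter_upwards [hK, hlarge (1 + r ^ 2) (1 / 8) (by positivity) (by norm_num),
    hlarge (|K| + 1 + (1 + r ^ 2)) (c / 32) (by positivity) (by positivity)] with n h1 h2 h3
  have hn : (0 : ℝ) ≤ n := n.cast_nonneg
  have h4 := hturan n
  have h5 : (extremalNumber n (completeGraph (Fin (r + 1))) : ℝ) ≤ f n := by exact_mod_cast hlow n
  have h6 : (f n : ℝ) ≤ extremalNumber n G + 1 := by exact_mod_cast hup n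
  have h7 : (1 / 2) * (n : ℝ) ^ 2 ≤ (1 - 1 / (r : ℝ)) * n ^ 2 := by gcongr; linarith
  have h8 : (n : ℝ) ^ 2 / 8 ≤ extremalNumber n (completeGraph (Fin (r + 1))) := by linarith
  have h9 : (1 - 1 / (r : ℝ) + min (c / 16) (1 / 2)) * (n * (n + 1) / 2) ≤
      (1 - 1 / (r : ℝ)) * n ^ 2 / 2 + c / 32 * n ^ 2 + n := by
    have e1 : min (c / 16) (1 / 2) * (n : ℝ) ^ 2 ≤ c / 16 * n ^ 2 := by
      gcongr; exact min_le_left _ _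
    have e2 : (1 - 1 / (r : ℝ) + min (c / 16) (1 / 2)) * (n : ℝ) ≤ 2 * n := by
      gcongr
      linarith [min_le_right (c / 16) (1 / 2)]
    linarith
  have h10 : c * ((n : ℝ) ^ 2 / 8) ≤ c * extremalNumber n (completeGraph (Fin (r + 1))) := by
    gcongr
  have h11 : 0 ≤ c * (n : ℝ) ^ 2 := by positivity
  rw [Pi.sub_apply, Real.norm_eq_abs, abs_of_nonneg (by linarith), Real.norm_eq_abs,
    abs_of_nonneg (by positivity)]
  linarith [le_abs_self K]

/-! ### F-colorings and K₂ -/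

namespace GraphFamily

variable {F : GraphFamily}

theorem Mem.congr {V W : Type*} {H : SimpleGraph V} {H' : SimpleGraph W} (h : F.Mem H)
    (e : H' ≃g H) : F.Mem H' := by
  obtain ⟨K, hK, ⟨e'⟩⟩ := h
  exact ⟨K, hK, ⟨e.trans e'⟩⟩

/-- A hereditary family with a nonempty member contains `K₂`. -/
theorem IsHereditary.mem_top (hF : F.IsHereditary)
    (hne : ∃ n : ℕ, ∃ H : SimpleGraph (Fin n), F.Mem H ∧ H ≠ ⊥) :
    F.Mem (⊤ : SimpleGraph (Fin 2)) := by
  obtain ⟨n, H, hH, hbot⟩ := hne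
  obtain ⟨u, v, huv⟩ := ne_bot_iff_exists_adj.1 hbot
  refine hF n 2 H ⊤ hH ⟨⟨⟨![u, v], ?_⟩, ?_⟩⟩ top_ne_bot ?_
  · intro a b hab
    fin_cases a <;> fin_cases b <;> simp_all [huv.symm]
  · intro a b hab
    have := huv.ne
    have := huv.ne'
    fin_cases a <;> fin_cases b <;> simp_all
  · ext a
    simp

/-- A graph with exactly one edge, restricted to the ends of this edge, is a `K₂`. -/
theorem mem_induce_support_of_unique (hK : F.Mem (⊤ : SimpleGraph (Fin 2))) {V : Type*}
    {H : SimpleGraph V} {u v : V} (huv : H.Adj u v)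
    (huniq : ∀ x y, H.Adj x y → s(x, y) = s(u, v)) : F.Mem (H.induce H.support) := by
  classical
  have hsupp : H.support = {u, v} := by
    ext x
    simp only [mem_support, Set.mem_insert_iff, Set.mem_singleton_iff]
    constructor
    · rintro ⟨y, hxy⟩
      rcases Sym2.eq_iff.1 (huniq x y hxy) with h | h
      · exact Or.inl h.1
      · exact Or.inr h.1
    · rintro (rfl | rfl)
      exacts [⟨v, huv⟩, ⟨u, huv.symm⟩]
  have htop : H.induce H.support = ⊤ := by
    ext ⟨x, hx⟩ ⟨y, hy⟩
    rw [hsupp] at hx hy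
    have := huv.ne
    have := huv.ne'
    have := huv.symm
    rcases hx with rfl | rfl <;> rcases hy with rfl | rfl <;> simp_all
  have hcard : Nat.card H.support = 2 := by
    rw [hsupp, Nat.card_coe_set_eq, Set.ncard_pair huv.ne]
  have : Finite H.support := Nat.finite_of_card_ne_zero (by omega)
  rw [htop]
  exact hK.congr (Iso.completeGraph ((Finite.equivFin _).trans (finCongr hcard)))

/-- A rainbow copy is an `F`-copy if `K₂` belongs to `F`. -/
theorem isFColoring_of_injective (hK : F.Mem (⊤ : SimpleGraph (Fin 2))) {V : Type*}
    {G : SimpleGraph V} {c : G.EdgeLabeling ℕ} (hc : Function.Injective c) : F.IsFColoring c := by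
  intro k hk
  obtain ⟨u, v, huv⟩ := ne_bot_iff_exists_adj.1 hk
  refine mem_induce_support_of_unique hK huv fun x y hxy => ?_
  rw [EdgeLabeling.labelGraph_adj] at huv hxy
  obtain ⟨h1, h2⟩ := huv
  obtain ⟨h3, h4⟩ := hxy
  exact congrArg Subtype.val (hc (h4.trans h2.symm))

theorem mem_usedColors_iff {V : Type*} {G : SimpleGraph V} {c : G.EdgeLabeling ℕ} {k : ℕ} :
    k ∈ usedColors c ↔ ∃ e, c e = k := by
  rw [usedColors, Set.mem_ofPred_eq, ne_bot_iff_exists_adj]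
  constructor
  · rintro ⟨u, v, h⟩
    obtain ⟨h1, h2⟩ := EdgeLabeling.labelGraph_adj u v |>.1 h
    exact ⟨_, h2⟩
  · rintro ⟨⟨e, he⟩, hk⟩
    induction e using Sym2.inductionOn with
    | hf u v => exact ⟨u, v, (EdgeLabeling.labelGraph_adj u v).2 ⟨he, hk⟩⟩

theorem usedColors_eq_range {V : Type*} {G : SimpleGraph V} (c : G.EdgeLabeling ℕ) :
    usedColors c = Set.range c :=
  Set.ext fun _ => mem_usedColors_iff

/-! ### Upper bound: rainbow copies -/

/-- An edge coloring with more than `ex(n, G)` colors has a rainbow copy of `G`. -/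
theorem exists_copy_injective_pullback {V : Type*} {G : SimpleGraph V} {n : ℕ}
    (c : TopEdgeLabeling (Fin n) ℕ) (hc : extremalNumber n G < (usedColors c).ncard) :
    ∃ φ : G.Copy (⊤ : SimpleGraph (Fin n)),
      Function.Injective (EdgeLabeling.pullback c φ.toHom) := by
  classical
  rw [usedColors_eq_range] at hc
  -- One representative edge per color; together they form a rainbow graph with as many edges as
  -- there are colors.
  let e : Set.range c → (⊤ : SimpleGraph (Fin n)).edgeSet := fun k => k.2.choose
  have he : ∀ k, c (e k) = k := fun k => k.2.choose_spec
  let s : Set (Sym2 (Fin n)) := Set.range fun k => (e k : Sym2 (Fin n))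
  have hs : (fromEdgeSet s).edgeSet = s := by
    rw [edgeSet_fromEdgeSet, sdiff_eq_left, Set.disjoint_left]
    rintro _ ⟨k, rfl⟩ hd
    exact not_isDiag_of_mem_edgeSet _ (e k).2 hd
  have hcard : s.ncard = (Set.range c).ncard := by
    rw [← Nat.card_coe_set_eq, ← Nat.card_coe_set_eq]
    refine Nat.card_range_of_injective fun k l hkl => ?_
    have := congrArg c (Subtype.ext hkl)
    rw [he, he] at this
    exact Subtype.ext this
  obtain ⟨φ⟩ : G ⊑ fromEdgeSet s := by
    apply IsContained.of_extremalNumber_lt_card_edgeFinset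
    rwa [Fintype.card_fin, ← Set.ncard_coe_finset, coe_edgeFinset, hs, hcard]
  refine ⟨(Copy.ofLE _ _ le_top).comp φ, ?_⟩
  have hmem : ∀ x : G.edgeSet, ∃ k, e k = (((Copy.ofLE _ _ le_top).comp φ).toHom.mapEdgeSet x :
      (⊤ : SimpleGraph (Fin n)).edgeSet) := by
    intro x
    obtain ⟨k, hk⟩ := hs.subset (φ.toHom.mapEdgeSet x).2
    refine ⟨k, Subtype.ext (hk.trans ?_)⟩
    rfl
  intro x y hxy
  rw [EdgeLabeling.pullback_apply, EdgeLabeling.pullback_apply] at hxy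
  obtain ⟨k, hk⟩ := hmem x
  obtain ⟨l, hl⟩ := hmem y
  rw [← hk, ← hl, he, he] at hxy
  apply Hom.mapEdgeSet.injective _ (Copy.injective ((Copy.ofLE _ _ le_top).comp φ))
  rw [← hk, ← hl, Subtype.ext hxy]

theorem antiRamsey_le (hK : F.Mem (⊤ : SimpleGraph (Fin 2))) {V : Type*} (G : SimpleGraph V)
    (n : ℕ) : F.antiRamsey G n ≤ extremalNumber n G + 1 := by
  refine Nat.sInf_le ⟨by omega, fun c hc => ?_⟩
  obtain ⟨φ, hφ⟩ := exists_copy_injective_pullback c hc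
  exact ⟨φ, isFColoring_of_injective hK hφ⟩

/-! ### Lower bound: a rainbow Turán graph -/

/-- Deleting a color class of an `F`-coloring gives a member of the `F`-deck. -/
theorem deleteEdges_labelGraph_mem_deck {V : Type*} {G : SimpleGraph V} {c : G.EdgeLabeling ℕ}
    (hc : F.IsFColoring c) {k : ℕ} (hk : k ∈ usedColors c) :
    G.deleteEdges (c.labelGraph k).edgeSet ∈ F.deck G := by
  let D : G.Subgraph :=
    { verts := (c.labelGraph k).support
      Adj := (c.labelGraph k).Adj
      adj_sub := fun h => c.labelGraph_le h
      edge_vert := fun {_ w} h => ⟨w, h⟩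
      symm := (c.labelGraph k).symm }
  refine ⟨D, (hc k hk).congr ⟨Equiv.refl _, Iff.rfl⟩, ?_⟩
  congr 1

/-- If every edge of the complete graph outside a `k`-colorable graph `T` has color `0`, then an
`F`-copy of `G` shows that `G` or a member of its `F`-deck is `k`-colorable. -/
theorem colorable_of_isFColoring {V W : Type*} {G : SimpleGraph V} {T : SimpleGraph W} {k : ℕ}
    (hT : T.Colorable k) {c : TopEdgeLabeling W ℕ} (hc : ∀ e, c e = 0 ∨ (e : Sym2 W) ∈ T.edgeSet)
    (φ : G.Copy (⊤ : SimpleGraph W)) (hφ : F.IsFColoring (EdgeLabeling.pullback c φ.toHom)) :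
    G.Colorable k ∨ F.reducedChromaticNumber G ≤ k := by
  obtain ⟨C⟩ := hT
  have hadj : ∀ u v (h : G.Adj u v), ¬ ((EdgeLabeling.pullback c φ.toHom).labelGraph 0).Adj u v →
      T.Adj (φ u) (φ v) := by
    intro u v h h0
    refine (hc (φ.toHom.mapEdgeSet ⟨s(u, v), h⟩)).resolve_left fun h1 => h0 ?_
    exact (EdgeLabeling.labelGraph_adj u v).2 ⟨h, h1⟩
  -- Edges of the copy not colored 0 map into T, so the coloring of T pulls back along φ. If color 0
  -- is absent, this colors G itself; no deck member is then supplied.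
  by_cases h0 : 0 ∈ usedColors (EdgeLabeling.pullback c φ.toHom)
  · refine Or.inr ((iInf₂_le _ (deleteEdges_labelGraph_mem_deck hφ h0)).trans ?_)
    refine Colorable.chromaticNumber_le ⟨Coloring.mk (fun v => C (φ v)) fun {u v} h => ?_⟩
    rw [deleteEdges_adj] at h
    exact C.valid (hadj u v h.1 h.2)
  · refine Or.inl ⟨Coloring.mk (fun v => C (φ v)) fun {u v} h => C.valid (hadj u v h fun h1 => ?_)⟩
    exact h0 (ne_bot_iff_exists_adj.2 ⟨u, v, h1⟩)

/-- There is an edge coloring of the complete graph in which the edges of `T` have distinct positive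
colors and all other edges have color `0`. -/
theorem exists_edgeLabeling_rainbow {W : Type*} [Fintype W] (T : SimpleGraph W)
    [DecidableRel T.Adj] :
    ∃ c : TopEdgeLabeling W ℕ, (∀ e, c e = 0 ∨ (e : Sym2 W) ∈ T.edgeSet) ∧
      T.edgeFinset.card ≤ (usedColors c).ncard := by
  classical
  let g := Fintype.equivFin (Sym2 W)
  let c : TopEdgeLabeling W ℕ := fun e => if (e : Sym2 W) ∈ T.edgeSet then (g e : ℕ) + 1 else 0
  refine ⟨c, fun e => ?_, ?_⟩
  · by_cases h : (e : Sym2 W) ∈ T.edgeSet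
    exacts [Or.inr h, Or.inl (if_neg h)]
  · rw [usedColors_eq_range, ← Finset.card_image_of_injective (f := fun e => (g e : ℕ) + 1),
      ← Set.ncard_coe_finset]
    · refine Set.ncard_le_ncard ?_ (Set.finite_range c)
      intro k hk
      obtain ⟨e, he, rfl⟩ := Finset.mem_image.1 (Finset.mem_coe.1 hk)
      rw [mem_edgeFinset] at he
      exact ⟨⟨e, edgeSet_mono le_top he⟩, if_pos he⟩
    · intro a b hab
      exact g.injective (Fin.ext (Nat.succ_injective hab))

/-- The coloring that is rainbow on T and 0 elsewhere has no F-copy of G, yet uses at least as many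
colors as T has edges. -/
theorem card_edgeFinset_lt_antiRamsey {V : Type*} {G : SimpleGraph V} {k n : ℕ}
    (hG : ¬ G.Colorable k) (hF : ¬ F.reducedChromaticNumber G ≤ k) {T : SimpleGraph (Fin n)}
    [DecidableRel T.Adj] (hT : T.Colorable k) : T.edgeFinset.card < F.antiRamsey G n := by
  -- Nonemptiness is essential, since `sInf ∅ = 0`. The witness works vacuously: no coloring uses
  -- more colors than there are edges.
  have hne : {m : ℕ | 1 ≤ m ∧ ∀ c : TopEdgeLabeling (Fin n) ℕ,
      m ≤ (usedColors c).ncard → ∃ φ : G.Copy (⊤ : SimpleGraph (Fin n)),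
        F.IsFColoring (EdgeLabeling.pullback c φ.toHom)}.Nonempty := by
    refine ⟨Nat.card (⊤ : SimpleGraph (Fin n)).edgeSet + 1, by omega, fun c hc => ?_⟩
    rw [usedColors_eq_range, ← Nat.card_coe_set_eq] at hc
    have := Finite.card_range_le c
    omega
  by_contra! hle
  obtain ⟨c, hc, hcard⟩ := exists_edgeLabeling_rainbow T
  obtain ⟨φ, hφ⟩ := (Nat.sInf_mem hne).2 c (hle.trans hcard)
  exact (colorable_of_isFColoring hT hc φ hφ).elim hG hF

end GraphFamily

theorem theoremt (F : GraphFamily) (hF : F.IsHereditary)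
    (hne : ∃ n : ℕ, ∃ H : SimpleGraph (Fin n), F.Mem H ∧ H ≠ ⊥)
    {V : Type*} [Fintype V] (G : SimpleGraph V) (hG : F.IsStable G)
    (h3 : 3 ≤ F.reducedChromaticNumber G) :
    (fun n : ℕ => (F.antiRamsey G n : ℝ)) ~[atTop]
      (fun n : ℕ => (SimpleGraph.extremalNumber n
        (SimpleGraph.completeGraph (Fin G.chromaticNumber.toNat)) : ℝ)) := by
  have hcol : G.Colorable G.chromaticNumber.toNat :=
    colorable_of_chromaticNumber_ne_top
      (chromaticNumber_ne_top_iff_exists.2 ⟨_, G.colorable_of_fintype⟩)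
  have htop : G.chromaticNumber ≠ ⊤ := chromaticNumber_ne_top_iff_exists.2 ⟨_, hcol⟩
  have hχ : ((G.chromaticNumber.toNat : ℕ) : ℕ∞) = G.chromaticNumber := ENat.natCast_toNat htop
  have hstable : F.reducedChromaticNumber G = G.chromaticNumber := hG
  rw [hstable, ← hχ] at h3
  have h3' : 3 ≤ G.chromaticNumber.toNat := by exact_mod_cast h3
  obtain ⟨r, hr⟩ : ∃ r, G.chromaticNumber.toNat = r + 1 := ⟨_, (Nat.sub_add_cancel (by omega)).symm⟩
  rw [hr] at hcol h3' hχ ⊢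
  have hlt : ¬ G.chromaticNumber ≤ r := by
    rw [← hχ]
    exact_mod_cast Nat.not_succ_le_self r
  have hncol : ¬ G.Colorable r := fun h => hlt h.chromaticNumber_le
  have hbot : G ≠ ⊥ := by
    rintro rfl
    exact hncol ⟨Coloring.mk (fun _ => ⟨0, by omega⟩) fun h => h.elim⟩
  refine isEquivalent_extremalNumber_completeGraph hbot hcol (by omega) (fun n => ?_)
    (GraphFamily.antiRamsey_le (hF.mem_top hne) G)
  have : Nontrivial (Fin (r + 1)) := Fin.nontrivial_iff_two_le.2 (by omega)
  rw [completeGraph, extremalNumber_top, Fintype.card_fin, Nat.add_sub_cancel]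
  -- Stability enters here: the reduced chromatic number also exceeds r. The Turán graph is
  -- r-colored by residues mod r.
  refine (GraphFamily.card_edgeFinset_lt_antiRamsey (k := r) hncol (hstable ▸ hlt) ?_).le
  exact ⟨Coloring.mk (fun v => ⟨v % r, Nat.mod_lt _ (by omega)⟩) fun {u v} h h1 =>
    h (Fin.ext_iff.1 h1)⟩
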